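/- Let $\mathbb{H}=\{z\in\mathbb{C}: z^6=1\}\cup\{0\}$, let $\omega=e^{2\pi i/6}$, and let $\mathbb{E}=\mathbb{Z}[\omega]\subset\mathbb{C}$ be the ring of Eisenstein integers. An $\mathbb{H}$-matrix is a complex matrix all of whose subdeterminants lie in $\mathbb{H}$. An $\mathbb{H}$-representation of a matroid $\mathcal{M}$ on a finite ground set $E$, $|E|=n$, is an $\mathbb{H}$-matrix $M$ with $n$ columns (and any finite number of rows), labelled bijectively by $E$, such that a subset of $E$ is independent in $\mathcal{M}$ if and only if the corresponding columns of $M$ are linearly independent over $\mathbb{C}$. For an $\mathbb{H}$-matrix $M$ with $n$ columns let $\mathrm{row}_{\mathbb{C}}(M)\subseteq\mathbb{C}^n$ be its row space, let $\Lambda^*_{\mathbb{E}}(M)=\mathrm{row}_{\mathbb{C}}(M)\cap\mathbb{E}^n$ and $\Lambda_{\mathbb{E}}(M)=\mathrm{row}_{\mathbb{C}}(M)^{\perp}\cap\mathbb{E}^n$, where $\perp$ is the orthogonal complement for the Hermitian inner product, and let $\mathrm{Jac}(M)$ be the $\mathbb{E}$-module $$\mathrm{Jac}(M)=\mathbb{E}^n/\bigl(\Lambda_{\mathbb{E}}(M)\oplus\Lambda^*_{\mathbb{E}}(M)\bigr).$$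 If $\mathcal{M}$ is a regular matroid, i.e. a matroid on a finite ground set that is represented over $\mathbb{R}$ by a totally unimodular matrix, then $\mathrm{Jac}(\mathcal{M})$ is well-defined: $\mathcal{M}$ has an $\mathbb{H}$-representation, and for any two $\mathbb{H}$-representations $M_1,M_2$ of $\mathcal{M}$ the $\mathbb{E}$-modules $\mathrm{Jac}(M_1)$ and $\mathrm{Jac}(M_2)$ are isomorphic. -/

import Mathlib

open scoped Matrix

namespace SixthRoot

/-- `ω = e^{2πi/6}`, a primitive sixth root of unity. -/
noncomputable def omega : ℂ := Complex.exp (2 * Real.pi * Complex.I / 6)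

/-- The ring of Eisenstein integers `ℤ[ω]`, as a subring of `ℂ`. -/
noncomputable abbrev Eisenstein : Subalgebra ℤ ℂ := Algebra.adjoin ℤ {omega}

/-- The set of complex sixth roots of unity together with `0`. -/
def H : Set ℂ := {z | z ^ 6 = 1} ∪ {0}

/-- An `H`-matrix: every subdeterminant lies in `H`. -/
def IsHMatrix {m n : ℕ} (A : Matrix (Fin m) (Fin n) ℂ) : Prop :=
  ∀ (k : ℕ) (f : Fin k → Fin m) (g : Fin k → Fin n), f.Injective → g.Injective →
    (A.submatrix f g).det ∈ H

/-- The matrix `A`, whose columns are labelled bijectively by the ground set of `M` through `e`,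
represents the matroid `M` over `F`: a set of elements is independent in `M` exactly when the
corresponding family of columns is linearly independent over `F`. -/
def Represents {α F : Type*} [Field F] (M : Matroid α) {m n : ℕ}
    (A : Matrix (Fin m) (Fin n) F) (e : Fin n ≃ M.E) : Prop :=
  ∀ J : Set (Fin n), M.Indep ((fun j => (e j : α)) '' J) ↔ LinearIndepOn F A.col J

/-- `A`, with its columns labelled by `e`, is an `H`-representation of `M`. The number of rows is
not required to be the rank of `M`. -/
def IsHRepresentation {α : Type*} (M : Matroid α) {m n : ℕ}
    (A : Matrix (Fin m) (Fin n) ℂ) (e : Fin n ≃ M.E) : Prop :=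
  IsHMatrix A ∧ Represents M A e

/-- A sixth-root-of-unity matroid: a matroid that has an `H`-representation. -/
def IsSixthRootMatroid {α : Type*} (M : Matroid α) : Prop :=
  ∃ (m n : ℕ) (A : Matrix (Fin m) (Fin n) ℂ) (e : Fin n ≃ M.E), IsHRepresentation M A e

/-- A regular matroid: a matroid represented over `ℝ` by a totally unimodular matrix. -/
def IsRegularMatroid {α : Type*} (M : Matroid α) : Prop :=
  ∃ (m n : ℕ) (A : Matrix (Fin m) (Fin n) ℝ) (e : Fin n ≃ M.E),
    A.IsTotallyUnimodular ∧ Represents M A e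

/-- The row space of `A` in `ℂⁿ` with its Hermitian inner product. -/
noncomputable def rowSpace {m n : ℕ} (A : Matrix (Fin m) (Fin n) ℂ) :
    Submodule ℂ (EuclideanSpace ℂ (Fin n)) :=
  Submodule.span ℂ (Set.range fun i => WithLp.toLp 2 (A.row i))

/-- The coordinatewise inclusion of `ℤ[ω]ⁿ` into `ℂⁿ`. -/
noncomputable def incl (n : ℕ) : (Fin n → Eisenstein) →ₗ[Eisenstein] EuclideanSpace ℂ (Fin n) where
  toFun v := WithLp.toLp 2 fun j => (v j : ℂ)
  map_add' v w := by ext j; simp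
  map_smul' c v := by ext j; simp [Subalgebra.smul_def]

/-- `Λ*(A)`: the vectors of `ℤ[ω]ⁿ` in the row space of `A`. -/
noncomputable def latticeStar {m n : ℕ} (A : Matrix (Fin m) (Fin n) ℂ) :
    Submodule Eisenstein (Fin n → Eisenstein) :=
  ((rowSpace A).restrictScalars Eisenstein).comap (incl n)

/-- `Λ(A)`: the vectors of `ℤ[ω]ⁿ` in the Hermitian orthogonal complement of the row space. -/
noncomputable def lattice {m n : ℕ} (A : Matrix (Fin m) (Fin n) ℂ) :
    Submodule Eisenstein (Fin n → Eisenstein) :=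
  ((rowSpace A)ᗮ.restrictScalars Eisenstein).comap (incl n)

/-- The sum of `Λ(A)` and `Λ*(A)` is direct. -/
theorem disjoint_lattice {m n : ℕ} (A : Matrix (Fin m) (Fin n) ℂ) :
    Disjoint (lattice A) (latticeStar A) := by
  rw [Submodule.disjoint_def]
  intro v h1 h2
  have h : incl n v = 0 :=
    (Submodule.disjoint_def.1 (rowSpace A).orthogonal_disjoint) _ h2 h1
  ext j
  have := congrArg (fun w : EuclideanSpace ℂ (Fin n) => w j) h
  simpa [incl] using this

/-- The Jacobian `ℤ[ω]ⁿ / (Λ(A) ⊕ Λ*(A))`, a `ℤ[ω]`-module. -/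
abbrev Jac {m n : ℕ} (A : Matrix (Fin m) (Fin n) ℂ) : Type :=
  (Fin n → Eisenstein) ⧸ (lattice A ⊔ latticeStar A)

end SixthRoot

/-!
A regular matroid is represented over `ℂ` by any of its totally unimodular matrices, and such a
matrix is an `H`-matrix. The point is uniqueness: every `H`-representation `A` has, up to relabelling
its columns and scaling them by sixth roots of unity, the row space of a fixed totally unimodular
representation `A₀` (`exists_rowSpace_eq`). Such a transformation of `ℂⁿ` is unitary and preserves
the vectors of Eisenstein integers, so it carries both lattices of `A₀` onto those of `A` and induces
an isomorphism of Jacobians (`nonempty_jac_equiv`).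

Uniqueness of the row space is the unique representability of regular matroids over a field, with
control of the scalars. Row reducing with respect to a basis of the matroid (`exists_standard_form`)
replaces `A` and `A₀` by matrices `X` and `X₀` with an identity submatrix. Their maximal minors are
ratios of subdeterminants of `A` and `A₀`, and single entries are such minors; so the nonzero entries
of `X` are sixth roots of unity, those of `X₀` are `±1`, and the matroid determines which minors
vanish, in particular where the nonzero entries are.

It remains to scale the rows and columns of `X₀` to obtain `X` (`exists_scaling`), one column at a
time. Say that `X` and `X₀` agree up to scaling on a set `S` of columns, and call two rows adjacent
when they meet a common column of `S`. A further column `n` can be added as soon as the ratio of its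
entries in `X` and in the scaled `X₀` is constant on each connected component of rows. In a shortest
path of rows along which this fails, the rows and columns of the path together with `n` form a
chordless cycle: each row of that square block has exactly two nonzero entries. Modulo `2` the
all-ones vector is in the kernel, so the corresponding minor of `X₀` is even; being `0` or `±1`, it
is zero (`even_det_of_even_row_sums`). Hence the minor of `X` vanishes too, and comparing kernel
vectors of the two blocks along the path shows that the ratios at its two ends are equal
(`closing_ratio_eq`, `ratio_eq_of_chordless`).
-/

namespace SixthRoot

/-! ### Minors and chordless cycles in standard form -/

section Core

variable {R C : Type*} [Fintype R] [DecidableEq R]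

/-- If a selection `c` of columns of a matrix in standard form is singular and keeps the unit column
of every row outside `I`, then already its block on `I` is singular. -/
lemma exists_kernel_on_of_det_eq_zero {F : Type*} [Field F] {X : Matrix R C F} {g : R → C}
    (hg : ∀ a b, X a (g b) = if a = b then 1 else 0) {I : Finset R} {c : R → C}
    (hc : ∀ b ∉ I, c b = g b) (hdet : (X.submatrix id c).det = 0) :
    ∃ v : R → F, (∃ b ∈ I, v b ≠ 0) ∧ ∀ b ∈ I, ∑ b' ∈ I, X b (c b') * v b' = 0 := by
  obtain ⟨v, hv, hXv⟩ := Matrix.exists_mulVec_eq_zero_iff.2 hdet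
  have key : ∀ b, ∑ b' ∈ I, X b (c b') * v b' + (if b ∈ I then 0 else v b) = 0 := by
    intro b
    have h := congrFun hXv b
    simp only [Matrix.mulVec, dotProduct, Matrix.submatrix_apply, id, Pi.zero_apply] at h
    rw [← Finset.sum_add_sum_compl I] at h
    refine Eq.trans ?_ h
    refine congrArg (_ + ·) (Eq.symm ?_)
    rw [Finset.sum_congr rfl (g := fun b' => if b = b' then v b' else 0)]
    · rw [Finset.sum_ite_eq]
      by_cases hb : b ∈ I <;> simp [hb]
    · intro b' hb'
      rw [hc b' (by simpa using hb'), hg]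
      split_ifs <;> simp
  refine ⟨v, ?_, fun b hb => by simpa [hb] using key b⟩
  by_contra! h0
  apply hv
  funext b
  by_cases hb : b ∈ I
  · exact h0 b hb
  · have := key b
    rw [Finset.sum_eq_zero (fun b' hb' => by rw [h0 b' hb', mul_zero])] at this
    simpa [hb] using this

/-- If the block of an integer standard-form matrix picked out by `I` and `c` has even row sums,
the corresponding maximal minor is even: modulo `2` the all-ones vector on `I` extends to a
kernel vector. -/
lemma even_det_of_even_row_sums {X : Matrix R C ℤ} {g : R → C}
    (hg : ∀ a b, X a (g b) = if a = b then 1 else 0) {I : Finset R} (hI : I.Nonempty) {c : R → C}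
    (hc : ∀ b ∉ I, c b = g b) (hsum : ∀ b ∈ I, ∑ b' ∈ I, (X b (c b') : ZMod 2) = 0) :
    (((X.submatrix id c).det : ℤ) : ZMod 2) = 0 := by
  have hcast : (((X.submatrix id c).det : ℤ) : ZMod 2)
      = ((X.submatrix id c).map (Int.castRingHom (ZMod 2))).det := by
    rw [← RingHom.mapMatrix_apply, ← RingHom.map_det]; simp
  rw [hcast, ← Matrix.exists_mulVec_eq_zero_iff]
  refine ⟨fun b => if b ∈ I then 1 else -∑ b' ∈ I, (X b (c b') : ZMod 2), ?_, ?_⟩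
  · obtain ⟨b, hb⟩ := hI
    intro h
    simpa [hb] using congrFun h b
  · funext b
    simp only [Matrix.mulVec, dotProduct, Matrix.map_apply, Matrix.submatrix_apply, id,
      Pi.zero_apply, eq_intCast]
    rw [← Finset.sum_add_sum_compl I]
    have h1 : ∑ b' ∈ I, ((X b (c b') : ZMod 2) *
        if b' ∈ I then 1 else -∑ b'' ∈ I, (X b' (c b'') : ZMod 2)) = ∑ b' ∈ I, (X b (c b') : ZMod 2) :=
      Finset.sum_congr rfl fun b' hb' => by simp [hb']
    have h2 : ∑ b' ∈ Iᶜ, ((X b (c b') : ZMod 2) *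
        if b' ∈ I then 1 else -∑ b'' ∈ I, (X b' (c b'') : ZMod 2)) =
        ∑ b' ∈ Iᶜ, if b = b' then -∑ b'' ∈ I, (X b' (c b'') : ZMod 2) else 0 :=
      Finset.sum_congr rfl fun b' hb' => by
        have hb'' : b' ∉ I := by simpa using hb'
        rw [hc b' hb'', hg, if_neg hb'']
        split_ifs <;> simp
    rw [h1, h2, Finset.sum_ite_eq]
    by_cases hb : b ∈ I
    · simp [hb, hsum b hb]
    · simp only [Finset.mem_compl, hb, not_false_eq_true, if_true, add_neg_cancel]

/-- A two-term linear recursion with zero initial value has only the zero solution. -/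
lemma eq_zero_of_chain {F : Type*} [Field F] {k : ℕ} {α β z : ℕ → F}
    (hβ : ∀ a < k, β a ≠ 0) (h0 : 0 < k → β 0 * z 0 = 0)
    (hs : ∀ a, a + 1 < k → α (a + 1) * z a + β (a + 1) * z (a + 1) = 0) :
    ∀ a < k, z a = 0 := by
  intro a
  induction a with
  | zero => intro h; exact (mul_eq_zero.1 (h0 h)).resolve_left (hβ 0 h)
  | succ a ih =>
    intro h
    have := hs a h
    rw [ih (by omega), mul_zero, zero_add] at this
    exact (mul_eq_zero.1 this).resolve_left (hβ _ h)

/-- Two cycle matrices share the entries `α`, `β` along the path, while the closing column has the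
entries `x`, `y` in one and `x * s`, `y * t` in the other. If both have nontrivial kernel vectors,
`(w, u)` and `(w', u')`, then `s = t`. -/
lemma closing_ratio_eq {F : Type*} [Field F] {k : ℕ} (hk : 0 < k) {α β w w' : ℕ → F}
    {x y s t u u' : F} (hβ : ∀ a < k, β a ≠ 0) (hy : y ≠ 0)
    (hw0 : β 0 * w 0 + x * u = 0)
    (hw : ∀ a, a + 1 < k → α (a + 1) * w a + β (a + 1) * w (a + 1) = 0)
    (hwk : α k * w (k - 1) + y * u = 0)
    (hw0' : β 0 * w' 0 + x * s * u' = 0)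
    (hw' : ∀ a, a + 1 < k → α (a + 1) * w' a + β (a + 1) * w' (a + 1) = 0)
    (hwk' : α k * w' (k - 1) + y * t * u' = 0)
    (hne : u ≠ 0 ∨ ∃ a < k, w a ≠ 0) (hne' : u' ≠ 0 ∨ ∃ a < k, w' a ≠ 0) : s = t := by
  have hu : u ≠ 0 := by
    rcases hne with h | ⟨a, ha, h⟩
    · exact h
    · rintro rfl
      exact h (eq_zero_of_chain hβ (fun _ => by simpa using hw0) hw a ha)
  have hu' : u' ≠ 0 := by
    rcases hne' with h | ⟨a, ha, h⟩
    · exact h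
    · rintro rfl
      exact h (eq_zero_of_chain hβ (fun _ => by simpa using hw0') hw' a ha)
  -- This combination of the two solutions vanishes at the start of the path, hence along it.
  have hz := eq_zero_of_chain (α := α) (z := fun a => s * u' * w a - u * w' a) hβ
    (fun _ => by linear_combination s * u' * hw0 - u * hw0')
    (fun a ha => by linear_combination s * u' * hw a ha - u * hw' a ha) (k - 1) (by omega)
  have : (s - t) * (y * u * u') = 0 := by
    linear_combination s * u' * hwk - u * hwk' - α k * hz
  have := (mul_eq_zero.1 this).resolve_right (by simp [hy, hu, hu'])
  exact sub_eq_zero.1 this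

/-- Swapping one unit column of a standard-form matrix for the column `j` isolates an entry. -/
lemma det_submatrix_update {F : Type*} [CommRing F] {X : Matrix R C F} {g : R → C}
    (hg : ∀ a b, X a (g b) = if a = b then 1 else 0) (i : R) (j : C) :
    (X.submatrix id (Function.update g i j)).det = X i j := by
  have : X.submatrix id (Function.update g i j) = (1 : Matrix R R F).updateCol i (X.col j) := by
    ext a b
    by_cases hb : b = i
    · subst hb; simp
    · simp [hb, hg, Matrix.one_apply]
  rw [this, ← Matrix.cramer_apply, Matrix.cramer_one]
  rfl

omit [Fintype R] in
/-- The row sums of a matrix whose nonzero pattern is that of a cycle: each has two terms. -/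
lemma sum_image_cycle {G : Type*} [AddCommMonoid G] {k : ℕ} (hk : 0 < k) {p : ℕ → R}
    (hp : Set.InjOn p (Set.Iic k)) {f : R → R → G}
    (hz : ∀ a ≤ k, ∀ l < k, a ≠ l → a ≠ l + 1 → f (p a) (p l) = 0)
    (hzn : ∀ a, 0 < a → a < k → f (p a) (p k) = 0) :
    (∑ b ∈ (Finset.range (k + 1)).image p, f (p 0) b = f (p 0) (p 0) + f (p 0) (p k)) ∧
    (∀ a, a + 1 < k → ∑ b ∈ (Finset.range (k + 1)).image p, f (p (a + 1)) b
      = f (p (a + 1)) (p a) + f (p (a + 1)) (p (a + 1))) ∧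
    (∑ b ∈ (Finset.range (k + 1)).image p, f (p k) b
      = f (p k) (p (k - 1)) + f (p k) (p k)) := by
  have hp' : Set.InjOn p (Finset.range (k + 1) : Set ℕ) := fun a ha b hb h =>
    hp (by simp at ha ⊢; omega) (by simp at hb ⊢; omega) h
  refine ⟨?_, fun a ha => ?_, ?_⟩ <;> rw [Finset.sum_image hp'] <;>
    refine Finset.sum_eq_add_of_mem _ _ (by simp; try omega) (by simp; try omega) (by omega) ?_
  · intro l hl hne
    simp only [Finset.mem_range] at hl
    exact hz 0 (by omega) l (by omega) (by omega) (by omega)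
  · intro l hl hne
    simp only [Finset.mem_range] at hl
    by_cases hlk : l = k
    · subst hlk; exact hzn _ (by omega) ha
    · exact hz _ ha.le l (by omega) (by omega) (by omega)
  · intro l hl hne
    simp only [Finset.mem_range] at hl
    exact hz k le_rfl l (by omega) (by omega) (by omega)

/-- A chordless path of rows `p 0, …, p k`, joined through columns `q 0, …, q (k - 1)` and closed
up by the column `n`. If `X` arises from `X₀` by scaling on the columns `q l`, the two matrices have
the same ratio in column `n` at both ends of the path. -/
lemma ratio_eq_of_chordless {F : Type*} [Field F] {X : Matrix R C F} {X₀ : Matrix R C ℤ}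
    {g : R → C} (hg : ∀ a b, X a (g b) = if a = b then 1 else 0)
    (hg₀ : ∀ a b, X₀ a (g b) = if a = b then 1 else 0)
    (hX₀ : ∀ c : R → C, (X₀.submatrix id c).det = 0 ∨ (X₀.submatrix id c).det = 1 ∨
      (X₀.submatrix id c).det = -1)
    (hdet : ∀ c : R → C, (X₀.submatrix id c).det = 0 → (X.submatrix id c).det = 0)
    (hsupp : ∀ i j, X i j = 0 ↔ (X₀ i j : F) = 0)
    {r : R → F} {d : C → F} (hr : ∀ i, r i ≠ 0) (hd : ∀ j, d j ≠ 0)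
    {k : ℕ} (hk : 0 < k) {p : ℕ → R} {q : ℕ → C} {n : C}
    (hS : ∀ i, ∀ l < k, X i (q l) = r i * X₀ i (q l) * d (q l))
    (hp : Set.InjOn p (Set.Iic k))
    (hq : ∀ a ≤ k, ∀ l < k, X₀ (p a) (q l) ≠ 0 ↔ a = l ∨ a = l + 1)
    (hn : ∀ a ≤ k, X₀ (p a) n ≠ 0 ↔ a = 0 ∨ a = k) :
    X (p 0) n / (r (p 0) * X₀ (p 0) n) = X (p k) n / (r (p k) * X₀ (p k) n) := by
  classical
  have hX₀e : ∀ i j, X₀ i j = 0 ∨ X₀ i j = 1 ∨ X₀ i j = -1 := fun i j => by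
    simpa only [det_submatrix_update hg₀] using hX₀ (Function.update g i j)
  have hcast : ∀ i j, X₀ i j ≠ 0 → (X₀ i j : F) ≠ 0 := fun i j h => by
    rcases hX₀e i j with h' | h' | h'
    · exact absurd h' h
    · simp [h']
    · simp [h']
  have hpar : ∀ i j, X₀ i j ≠ 0 → (X₀ i j : ZMod 2) = 1 := fun i j h => by
    rcases hX₀e i j with h' | h' | h'
    · exact absurd h' h
    · simp [h']
    · simp [h']
  set Q : ℕ → C := fun l => if l < k then q l else n with hQ
  have hQl : ∀ l < k, Q l = q l := fun l hl => by simp [hQ, hl]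
  have hQk : Q k = n := by simp [hQ]
  set I : Finset R := (Finset.range (k + 1)).image p with hI
  have hpI : ∀ a ≤ k, p a ∈ I := fun a ha => Finset.mem_image_of_mem p (by simp; omega)
  set c : R → C := fun b => if b ∈ I then Q (Function.invFunOn p (Set.Iic k) b) else g b with hc
  have hcI : ∀ b ∉ I, c b = g b := fun b hb => by simp [hc, hb]
  have hcp : ∀ a ≤ k, c (p a) = Q a := fun a ha => by
    simp only [hc, hpI a ha, if_true]
    rw [hp.leftInvOn_invFunOn ha]
  have hz : ∀ a ≤ k, ∀ l < k, a ≠ l → a ≠ l + 1 → X₀ (p a) (c (p l)) = 0 := by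
    intro a ha l hl h1 h2
    rw [hcp l hl.le, hQl l hl]
    by_contra h
    rcases (hq a ha l hl).1 h with h | h <;> contradiction
  have hzn : ∀ a, 0 < a → a < k → X₀ (p a) (c (p k)) = 0 := by
    intro a h0 ha
    rw [hcp k le_rfl, hQk]
    by_contra h
    rcases (hn a ha.le).1 h with h | h <;> omega
  have hrow : ∀ (P : R → Prop), P (p 0) → (∀ a, a + 1 < k → P (p (a + 1))) → P (p k) →
      ∀ b ∈ I, P b := by
    intro P h0 hs hk' b hb
    obtain ⟨a, ha, rfl⟩ := Finset.mem_image.1 hb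
    simp only [Finset.mem_range] at ha
    rcases a with _ | a
    · exact h0
    · by_cases h : a + 1 = k
      · rw [h]; exact hk'
      · exact hs a (by omega)
  have hβ : ∀ a < k, X₀ (p a) (q a) ≠ 0 := fun a ha => (hq a ha.le a ha).2 (Or.inl rfl)
  have hα : ∀ a < k, X₀ (p (a + 1)) (q a) ≠ 0 := fun a ha => (hq (a + 1) ha a ha).2 (Or.inr rfl)
  have hαk : X₀ (p k) (q (k - 1)) ≠ 0 := (hq k le_rfl (k - 1) (by omega)).2 (Or.inr (by omega))
  have hx : X₀ (p 0) n ≠ 0 := (hn 0 (by omega)).2 (Or.inl rfl)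
  have hy : X₀ (p k) n ≠ 0 := (hn k le_rfl).2 (Or.inr rfl)
  -- The minor is an even element of `{0, 1, -1}`.
  have hdet₀ : (X₀.submatrix id c).det = 0 := by
    have heven := even_det_of_even_row_sums hg₀ (I := I) ⟨_, hpI 0 (by omega)⟩ hcI ?_
    · rcases hX₀ c with h | h | h
      · exact h
      · simp [h] at heven
      · simp [h] at heven
    · obtain ⟨h0, hs, hk'⟩ := sum_image_cycle hk hp (f := fun a b => (X₀ a (c b) : ZMod 2))
        (fun a ha l hl h1 h2 => by simp [hz a ha l hl h1 h2]) (fun a h0 ha => by simp [hzn a h0 ha])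
      have h11 : (1 : ZMod 2) + 1 = 0 := by decide
      refine hrow _ ?_ ?_ ?_
      · rw [h0, hcp 0 (by omega), hcp k le_rfl, hQl 0 hk, hQk, hpar _ _ (hβ 0 hk), hpar _ _ hx, h11]
      · intro a ha
        rw [hs a ha, hcp a (by omega), hcp (a + 1) (by omega), hQl a (by omega),
          hQl (a + 1) (by omega), hpar _ _ (hα a (by omega)), hpar _ _ (hβ _ ha), h11]
      · rw [hk', hcp (k - 1) (by omega), hcp k le_rfl, hQl (k - 1) (by omega), hQk,
          hpar _ _ hαk, hpar _ _ hy, h11]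
  have hdet₁ : ((X₀.map (Int.castRingHom F)).submatrix id c).det = 0 := by
    rw [Matrix.submatrix_map, ← RingHom.mapMatrix_apply, ← RingHom.map_det, hdet₀, map_zero]
  obtain ⟨v, hv, hvI⟩ := exists_kernel_on_of_det_eq_zero
    (g := g) (fun a b => by simp only [Matrix.map_apply, hg₀]; split_ifs <;> simp) hcI hdet₁
  obtain ⟨v', hv', hvI'⟩ := exists_kernel_on_of_det_eq_zero hg hcI (hdet c hdet₀)
  obtain ⟨e0, es, ek⟩ := sum_image_cycle hk hp (f := fun a b => (X₀ a (c b) : F) * v b)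
    (fun a ha l hl h1 h2 => by simp [hz a ha l hl h1 h2]) (fun a h0 ha => by simp [hzn a h0 ha])
  obtain ⟨e0', es', ek'⟩ := sum_image_cycle hk hp (f := fun a b => X a (c b) * v' b)
    (fun a ha l hl h1 h2 => by
      simp [(hsupp (p a) (c (p l))).2 (by simp [hz a ha l hl h1 h2])])
    (fun a h0 ha => by simp [(hsupp (p a) (c (p k))).2 (by simp [hzn a h0 ha])])
  have hnt : ∀ (w : R → F) (f : C → F), (∀ j, f j ≠ 0) → (∃ b ∈ I, w b ≠ 0) →
      w (p k) ≠ 0 ∨ ∃ a < k, f (q a) * w (p a) ≠ 0 := by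
    rintro w f hf ⟨b, hb, hwb⟩
    obtain ⟨a, ha, rfl⟩ := Finset.mem_image.1 hb
    simp only [Finset.mem_range] at ha
    by_cases h : a = k
    · subst h; exact Or.inl hwb
    · exact Or.inr ⟨a, by omega, mul_ne_zero (hf _) hwb⟩
  refine closing_ratio_eq hk (α := fun a => (X₀ (p a) (q (a - 1)) : F))
    (β := fun a => (X₀ (p a) (q a) : F)) (w := fun a => 1 * v (p a))
    (w' := fun a => d (q a) * v' (p a)) (x := X₀ (p 0) n) (y := X₀ (p k) n) (u := v (p k))
    (u' := v' (p k)) (fun a ha => hcast _ _ (hβ a ha)) (hcast _ _ hy) ?_ ?_ ?_ ?_ ?_ ?_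
    (hnt v (fun _ => 1) (fun _ => one_ne_zero) hv) (hnt v' d hd hv')
  · have := hvI (p 0) (hpI 0 (by omega))
    simp only [Matrix.map_apply, eq_intCast] at this
    rw [e0, hcp 0 (by omega), hcp k le_rfl, hQl 0 hk, hQk] at this
    linear_combination this
  · intro a ha
    have := hvI (p (a + 1)) (hpI _ ha.le)
    simp only [Matrix.map_apply, eq_intCast] at this
    rw [es a ha, hcp a (by omega), hcp (a + 1) (by omega), hQl a (by omega),
      hQl (a + 1) (by omega)] at this
    simp only [Nat.add_sub_cancel]
    linear_combination this
  · have := hvI (p k) (hpI _ le_rfl)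
    simp only [Matrix.map_apply, eq_intCast] at this
    rw [ek, hcp (k - 1) (by omega), hcp k le_rfl, hQl (k - 1) (by omega), hQk] at this
    linear_combination this
  · have := hvI' (p 0) (hpI 0 (by omega))
    rw [e0', hcp 0 (by omega), hcp k le_rfl, hQl 0 hk, hQk, hS _ 0 hk] at this
    have h1 := hr (p 0)
    have h2 := hcast _ _ hx
    field_simp
    linear_combination this
  · intro a ha
    have := hvI' (p (a + 1)) (hpI _ ha.le)
    rw [es' a ha, hcp a (by omega), hcp (a + 1) (by omega), hQl a (by omega),
      hQl (a + 1) (by omega), hS _ a (by omega), hS _ _ ha] at this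
    simp only [Nat.add_sub_cancel]
    apply mul_left_cancel₀ (hr (p (a + 1)))
    linear_combination this
  · have := hvI' (p k) (hpI _ le_rfl)
    rw [ek', hcp (k - 1) (by omega), hcp k le_rfl, hQl (k - 1) (by omega), hQk,
      hS _ (k - 1) (by omega)] at this
    have h1 := hr (p k)
    have h2 := hcast _ _ hy
    field_simp
    linear_combination this

end Core

/-! ### Scaling a unimodular matrix -/

section Scaling

variable {R C F : Type*} [Fintype R] [DecidableEq R] [Field F]

/-- The conclusion of `ratio_eq_of_chordless` for an arbitrary path of rows joined through columns
in `S`: a path with a chord, or with an inner row that meets column `n`, splits into shorter ones. -/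
lemma ratio_eq_of_path {X : Matrix R C F} {X₀ : Matrix R C ℤ}
    {g : R → C} (hg : ∀ a b, X a (g b) = if a = b then 1 else 0)
    (hg₀ : ∀ a b, X₀ a (g b) = if a = b then 1 else 0)
    (hX₀ : ∀ c : R → C, (X₀.submatrix id c).det = 0 ∨ (X₀.submatrix id c).det = 1 ∨
      (X₀.submatrix id c).det = -1)
    (hdet : ∀ c : R → C, (X₀.submatrix id c).det = 0 → (X.submatrix id c).det = 0)
    (hsupp : ∀ i j, X i j = 0 ↔ (X₀ i j : F) = 0)
    {r : R → F} {d : C → F} (hr : ∀ i, r i ≠ 0) (hd : ∀ j, d j ≠ 0)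
    {S : Set C} (hS : ∀ i, ∀ j ∈ S, X i j = r i * X₀ i j * d j) {n : C} (k : ℕ) :
    ∀ p : ℕ → R, (∀ l < k, ∃ j ∈ S, X₀ (p l) j ≠ 0 ∧ X₀ (p (l + 1)) j ≠ 0) →
      X₀ (p 0) n ≠ 0 → X₀ (p k) n ≠ 0 →
      X (p 0) n / (r (p 0) * X₀ (p 0) n) = X (p k) n / (r (p k) * X₀ (p k) n) := by
  induction k using Nat.strong_induction_on with
  | _ k ih =>
  intro p hp h0 hk
  by_cases h0k : p 0 = p k
  · rw [h0k]
  have hkpos : 0 < k := Nat.pos_of_ne_zero fun h => h0k (by rw [h])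
  -- An inner row meeting column `n` splits the path in two.
  by_cases hin : ∃ a, 0 < a ∧ a < k ∧ X₀ (p a) n ≠ 0
  · obtain ⟨a, ha0, hak, ha⟩ := hin
    have h1 := ih a hak p (fun l hl => hp l (by omega)) h0 ha
    have h2 := ih (k - a) (by omega) (fun l => p (a + l)) (fun l hl => hp (a + l) (by omega))
      ha (by simpa [show a + (k - a) = k by omega] using hk)
    simp only [show a + (k - a) = k by omega, add_zero] at h2
    exact h1.trans h2
  -- A column of `S` joining rows `a` and `b` that are not consecutive bypasses the rows between.
  by_cases hsc : ∃ a b, a + 1 < b ∧ b ≤ k ∧ ∃ j ∈ S, X₀ (p a) j ≠ 0 ∧ X₀ (p b) j ≠ 0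
  · obtain ⟨a, b, hab, hbk, hj⟩ := hsc
    have h1 := ih (k - (b - a - 1)) (by omega)
      (fun l => if l ≤ a then p l else p (l + (b - a - 1))) (fun l hl => ?_)
      (by simpa using h0) ?_
    · simp only [Nat.zero_le, if_true, show ¬ (k - (b - a - 1) ≤ a) by omega, if_false,
        show k - (b - a - 1) + (b - a - 1) = k by omega] at h1
      exact h1
    · rcases lt_trichotomy l a with h | h | h
      · simpa [h.le, show l + 1 ≤ a by omega] using hp l (by omega)
      · subst h
        simpa [show l + 1 + (b - l - 1) = b by omega] using hj
      · simpa [show ¬ l ≤ a by omega, show ¬ l + 1 ≤ a by omega,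
          show l + 1 + (b - a - 1) = l + (b - a - 1) + 1 by omega] using
          hp (l + (b - a - 1)) (by omega)
    · simpa [show ¬ (k - (b - a - 1) ≤ a) by omega,
        show k - (b - a - 1) + (b - a - 1) = k by omega] using hk
  have hsc' : ∀ a b, a + 1 < b → b ≤ k → ∀ j ∈ S, X₀ (p a) j ≠ 0 → X₀ (p b) j ≠ 0 → False :=
    fun a b h1 h2 j hj h3 h4 => hsc ⟨a, b, h1, h2, j, hj, h3, h4⟩
  have : Nonempty C := ⟨n⟩
  choose! q hqS hql hqr using hp
  -- A repeated row gives a chord from a neighbour of one occurrence to the other occurrence.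
  have hne : ∀ a b, a < b → b ≤ k → p a ≠ p b := by
    intro a b hab hbk h
    rcases hbk.lt_or_eq with hbk | rfl
    · exact hsc' a (b + 1) (by omega) hbk (q b) (hqS b hbk) (h ▸ hql b hbk) (hqr b hbk)
    · rcases Nat.eq_zero_or_pos a with rfl | ha
      · exact h0k h
      · have h1 := hqr (a - 1) (by omega)
        rw [show a - 1 + 1 = a by omega, h] at h1
        exact hsc' (a - 1) b (by omega) le_rfl (q (a - 1)) (hqS _ (by omega)) (hql _ (by omega)) h1
  refine ratio_eq_of_chordless hg hg₀ hX₀ hdet hsupp hr hd hkpos (q := q)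
    (fun i l hl => hS i _ (hqS l hl)) ?_ ?_ ?_
  · intro a ha b hb h
    rcases lt_trichotomy a b with h' | h' | h'
    · exact absurd h (hne a b h' hb)
    · exact h'
    · exact absurd h.symm (hne b a h' ha)
  · intro a ha l hl
    refine ⟨fun h => ?_, ?_⟩
    · by_contra! hcon
      rcases lt_or_gt_of_ne hcon.1 with h' | h'
      · exact hsc' a (l + 1) (by omega) hl (q l) (hqS l hl) h (hqr l hl)
      · exact hsc' l a (by omega) ha (q l) (hqS l hl) (hql l hl) h
    · rintro (rfl | rfl)
      · exact hql _ hl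
      · exact hqr l hl
  · intro a ha
    refine ⟨fun h => ?_, ?_⟩
    · by_contra! hcon
      exact hin ⟨a, by omega, by omega, h⟩
    · rintro (rfl | rfl)
      · exact h0
      · exact hk

/-- Unique representability over a field, in standard form: a matrix whose nonzero entries are sixth
roots of unity, and whose singular selections of columns include those of a unimodular integer
matrix with the same nonzero pattern, is obtained from the latter by scaling rows and columns by
sixth roots of unity. -/
theorem exists_scaling [Finite C] {X : Matrix R C F} {X₀ : Matrix R C ℤ}
    {g : R → C} (hg : ∀ a b, X a (g b) = if a = b then 1 else 0)
    (hg₀ : ∀ a b, X₀ a (g b) = if a = b then 1 else 0)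
    (hX₀ : ∀ c : R → C, (X₀.submatrix id c).det = 0 ∨ (X₀.submatrix id c).det = 1 ∨
      (X₀.submatrix id c).det = -1)
    (hdet : ∀ c : R → C, (X₀.submatrix id c).det = 0 → (X.submatrix id c).det = 0)
    (hsupp : ∀ i j, X i j = 0 ↔ (X₀ i j : F) = 0)
    (hX : ∀ i j, X i j ≠ 0 → X i j ^ 6 = 1) :
    ∃ (r : R → F) (d : C → F), (∀ i, r i ^ 6 = 1) ∧ (∀ j, d j ^ 6 = 1) ∧
      ∀ i j, X i j = r i * X₀ i j * d j := by
  classical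
  have hne : ∀ {x : F}, x ^ 6 = 1 → x ≠ 0 := fun h h' => by simp [h'] at h
  have := Fintype.ofFinite C
  suffices h : ∀ S : Finset C, ∃ (r : R → F) (d : C → F), (∀ i, r i ^ 6 = 1) ∧
      (∀ j, d j ^ 6 = 1) ∧ ∀ i, ∀ j ∈ S, X i j = r i * X₀ i j * d j by
    obtain ⟨r, d, hr, hd, h⟩ := h Finset.univ
    exact ⟨r, d, hr, hd, fun i j => h i j (Finset.mem_univ j)⟩
  intro S
  induction S using Finset.induction_on with
  | empty => exact ⟨fun _ => 1, fun _ => 1, by simp, by simp, by simp⟩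
  | insert n S hnS ih =>
  obtain ⟨r, d, hr, hd, hS⟩ := ih
  have hX₀6 : ∀ i j, X₀ i j ≠ 0 → (X₀ i j : F) ^ 6 = 1 := fun i j h => by
    have h1 := hX₀ (Function.update g i j)
    rw [det_submatrix_update hg₀] at h1
    rcases h1 with h' | h' | h'
    · exact absurd h' h
    · simp [h']
    · simp [h', Even.neg_pow (show Even 6 by decide)]
  set Y : R → F := fun i => X i n / (r i * X₀ i n) with hY
  have hY6 : ∀ i, X₀ i n ≠ 0 → Y i ^ 6 = 1 := fun i h => by
    simp only [hY]
    rw [div_pow, mul_pow, hr, hX₀6 i n h, hX i n (fun h' => hne (hX₀6 i n h) ((hsupp i n).1 h'))]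
    simp
  -- Rows are adjacent when they meet a common column of `S`; `Y` is constant on the rows of a
  -- component that meet column `n`, so it extends to a function `t` constant on components.
  set Adj : R → R → Prop := fun a b => ∃ j ∈ S, X₀ a j ≠ 0 ∧ X₀ b j ≠ 0 with hAdj
  have hsymm : ∀ a b, Relation.ReflTransGen Adj a b → Relation.ReflTransGen Adj b a := by
    have : Std.Symm Adj := ⟨fun a b ⟨j, hj, h1, h2⟩ => ⟨j, hj, h2, h1⟩⟩
    exact fun a b h => Std.Symm.symm a b h
  have hpath : ∀ a b, Relation.ReflTransGen Adj a b →
      ∃ (k : ℕ) (p : ℕ → R), p 0 = a ∧ p k = b ∧ ∀ l < k, Adj (p l) (p (l + 1)) := by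
    intro a b h
    induction h with
    | refl => exact ⟨0, fun _ => a, rfl, rfl, by simp⟩
    | @tail b c _ hbc ih =>
      obtain ⟨k, p, h0, hk, hp⟩ := ih
      refine ⟨k + 1, fun l => if l ≤ k then p l else c, by simpa using h0, by simp, ?_⟩
      intro l hl
      rcases Nat.lt_succ_iff_lt_or_eq.1 hl with h | rfl
      · simpa [h.le, show l + 1 ≤ k from h] using hp l h
      · simpa [hk] using hbc
  have hYeq : ∀ a b, Relation.ReflTransGen Adj a b → X₀ a n ≠ 0 → X₀ b n ≠ 0 → Y a = Y b := by
    intro a b h ha hb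
    obtain ⟨k, p, rfl, rfl, hp⟩ := hpath a b h
    exact ratio_eq_of_path hg hg₀ hX₀ hdet hsupp (fun i => hne (hr i)) (fun j => hne (hd j))
      (S := (S : Set C)) hS k p hp ha hb
  obtain ⟨t, ht6, htY, htA⟩ : ∃ t : R → F, (∀ i, t i ^ 6 = 1) ∧ (∀ i, X₀ i n ≠ 0 → t i = Y i) ∧
      ∀ a b, Adj a b → t a = t b := by
    refine ⟨fun i => if h : ∃ b, Relation.ReflTransGen Adj i b ∧ X₀ b n ≠ 0 then Y h.choose else 1,
      fun i => ?_, fun i hi => ?_, fun a b hab => ?_⟩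
    · dsimp only
      split_ifs with h
      · exact hY6 _ h.choose_spec.2
      · simp
    · have h : ∃ b, Relation.ReflTransGen Adj i b ∧ X₀ b n ≠ 0 := ⟨i, .refl, hi⟩
      simp only [h, dif_pos]
      exact (hYeq _ _ h.choose_spec.1 hi h.choose_spec.2).symm
    · have hab' := Relation.ReflTransGen.single hab
      by_cases ha : ∃ x, Relation.ReflTransGen Adj a x ∧ X₀ x n ≠ 0
      · have hb : ∃ x, Relation.ReflTransGen Adj b x ∧ X₀ x n ≠ 0 :=
          ⟨_, (hsymm _ _ hab').trans ha.choose_spec.1, ha.choose_spec.2⟩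
        simp only [ha, hb, dif_pos]
        exact hYeq _ _ ((hsymm _ _ ha.choose_spec.1).trans (hab'.trans hb.choose_spec.1))
          ha.choose_spec.2 hb.choose_spec.2
      · have hb : ¬ ∃ x, Relation.ReflTransGen Adj b x ∧ X₀ x n ≠ 0 :=
          fun ⟨x, h1, h2⟩ => ha ⟨x, hab'.trans h1, h2⟩
        simp only [ha, hb, dif_neg, not_false_eq_true]
  have hu : ∀ j, ∃ u : F, u ^ 6 = 1 ∧ (j ∈ S → ∀ i, X₀ i j ≠ 0 → t i = u) := by
    intro j
    by_cases h : ∃ i, X₀ i j ≠ 0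
    · obtain ⟨i, hi⟩ := h
      exact ⟨t i, ht6 i, fun hj a ha => htA a i ⟨j, hj, ha, hi⟩⟩
    · exact ⟨1, by simp, fun _ a ha => absurd ⟨a, ha⟩ h⟩
  choose u hu6 hut using hu
  refine ⟨fun i => r i * t i, fun j => if j = n then 1 else d j / u j, fun i => ?_, fun j => ?_, ?_⟩
  · rw [mul_pow, hr, ht6, one_mul]
  · dsimp only
    split_ifs
    · simp
    · rw [div_pow, hd, hu6, div_one]
  · intro i j hj
    by_cases h0 : X₀ i j = 0
    · simp [h0, (hsupp i j).2 (by simp [h0])]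
    · have h0' := hne (hX₀6 i j h0)
      rcases Finset.mem_insert.1 hj with rfl | hj
      · simp only [if_true, htY i h0, hY]
        have := hne (hr i)
        field_simp
      · have hjn : j ≠ n := fun h => hnS (h ▸ hj)
        simp only [hjn, if_false]
        rw [hut j hj i h0, hS i j hj]
        have := hne (hu6 j)
        field_simp

end Scaling

/-! ### Standard form -/

section StandardForm

variable {F : Type*} [Field F] {m n r : ℕ}

lemma linearIndependent_col_comp_iff {A : Matrix (Fin m) (Fin n) F} {X : Matrix (Fin r) (Fin n) F}
    {P : Matrix (Fin m) (Fin r) F} {Q : Matrix (Fin r) (Fin m) F} (hP : A = P * X) (hQ : X = Q * A)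
    {ι : Type*} (c : ι → Fin n) :
    LinearIndependent F (A.col ∘ c) ↔ LinearIndependent F (X.col ∘ c) := by
  constructor <;> intro h
  · refine LinearIndependent.of_comp P.mulVecLin ?_
    convert h using 1
    funext i
    rw [hP]
    rfl
  · refine LinearIndependent.of_comp Q.mulVecLin ?_
    convert h using 1
    funext i
    rw [hQ]
    rfl

lemma det_submatrix_ne_zero_iff (X : Matrix (Fin r) (Fin n) F) (c : Fin r → Fin n) :
    (X.submatrix id c).det ≠ 0 ↔ LinearIndependent F (X.col ∘ c) := by
  rw [← isUnit_iff_ne_zero, ← Matrix.isUnit_iff_isUnit_det,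
    ← Matrix.linearIndependent_cols_iff_isUnit]
  rfl

/-- A matrix with linearly independent columns has a nonsingular maximal square submatrix. -/
lemma exists_det_submatrix_ne_zero (P : Matrix (Fin m) (Fin r) F)
    (hP : LinearIndependent F P.col) : ∃ f : Fin r → Fin m, (P.submatrix f id).det ≠ 0 := by
  obtain ⟨b, -, -, hspan, hb⟩ := exists_linearIndepOn_extension (K := F) (v := P.row)
    (linearIndepOn_empty F _) (Set.empty_subset Set.univ)
  classical
  have := Fintype.ofFinite b
  have hcard : Fintype.card b = r := by
    have h1 : Submodule.span F (Set.range P.row) = Submodule.span F (P.row '' b) := by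
      apply le_antisymm
      · rw [Submodule.span_le, ← Set.image_univ]; exact hspan
      · exact Submodule.span_mono (Set.image_subset_range _ _)
    have h2 := P.rank_eq_finrank_span_row
    have h3 : P.rank = r := by
      have := LinearIndependent.rank_matrix (M := Pᵀ) hP
      rwa [Matrix.rank_transpose, Fintype.card_fin] at this
    rw [h1, Set.image_eq_range] at h2
    rw [← h3, h2, ← finrank_span_eq_card hb]
  let e : Fin r ≃ b := (Fintype.equivFinOfCardEq hcard).symm
  refine ⟨fun i => e i, ?_⟩
  rw [← isUnit_iff_ne_zero, ← Matrix.isUnit_iff_isUnit_det,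
    ← Matrix.linearIndependent_rows_iff_isUnit]
  exact LinearIndependent.comp hb e e.injective

/-- Row reduction with respect to a column basis `g`: the matrix `X` has the unit vectors as its
columns `g`, has the row space of `A`, and its maximal minors are those of `A` on suitable rows `f`,
up to a common nonzero factor. -/
lemma exists_standard_form (A : Matrix (Fin m) (Fin n) F) (g : Fin r → Fin n)
    (hg : LinearIndependent F (A.col ∘ g))
    (hspan : ∀ j, A.col j ∈ Submodule.span F (Set.range (A.col ∘ g))) :
    ∃ (X : Matrix (Fin r) (Fin n) F) (P : Matrix (Fin m) (Fin r) F) (Q : Matrix (Fin r) (Fin m) F)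
      (f : Fin r → Fin m), (∀ a b, X a (g b) = if a = b then 1 else 0) ∧ A = P * X ∧ X = Q * A ∧
        ∀ c : Fin r → Fin n,
          (X.submatrix id c).det = (A.submatrix f c).det / (A.submatrix f g).det := by
  set P := A.submatrix id g with hPdef
  have hPcol : LinearIndependent F P.col := hg
  have hinj := Matrix.mulVec_injective_iff.2 hPcol
  simp only [Submodule.mem_span_range_iff_exists_fun] at hspan
  choose x hx using hspan
  set X : Matrix (Fin r) (Fin n) F := Matrix.of fun b j => x j b with hXdef
  have hPX : A = P * X := by
    ext i j
    have := congrFun (hx j) i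
    simp only [Finset.sum_apply, Pi.smul_apply, Function.comp, Matrix.col_apply, smul_eq_mul] at this
    rw [← this, Matrix.mul_apply]
    exact Finset.sum_congr rfl fun b _ => mul_comm _ _
  obtain ⟨f, hf⟩ := exists_det_submatrix_ne_zero P hPcol
  have hfg : P.submatrix f id = A.submatrix f g := rfl
  rw [hfg] at hf
  have hfX : A.submatrix f id = A.submatrix f g * X := by
    conv_lhs => rw [hPX]
    rfl
  refine ⟨X, P, (A.submatrix f g)⁻¹ * (1 : Matrix (Fin m) (Fin m) F).submatrix f id, f, ?_, hPX,
    ?_, ?_⟩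
  · intro a b
    have h : P *ᵥ X.col (g b) = P *ᵥ Pi.single b 1 := by
      rw [Matrix.mulVec_single_one]
      have : P *ᵥ X.col (g b) = (P * X).col (g b) := rfl
      rw [this, ← hPX]
      rfl
    have := congrFun (hinj h) a
    rw [Matrix.col_apply, Pi.single_apply] at this
    exact this
  · have : (1 : Matrix (Fin m) (Fin m) F).submatrix f id * A = A.submatrix f id := by
      ext i j
      simp [Matrix.mul_apply, Matrix.one_apply]
    rw [Matrix.mul_assoc, this, hfX, Matrix.nonsing_inv_mul_cancel_left]
    exact isUnit_iff_ne_zero.2 hf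
  · intro c
    have : A.submatrix f c = A.submatrix f g * X.submatrix id c := by
      conv_lhs => rw [hPX]
      rfl
    rw [this, Matrix.det_mul, mul_div_cancel_left₀ _ hf]

end StandardForm

/-! ### Row spaces -/

section RowSpace

/-- The injectivity in `IsHMatrix` is no restriction: repeated rows or columns give `0`. -/
lemma IsHMatrix.det_submatrix_mem {m n k : ℕ} {A : Matrix (Fin m) (Fin n) ℂ} (hA : IsHMatrix A)
    (f : Fin k → Fin m) (g : Fin k → Fin n) : (A.submatrix f g).det ∈ H := by
  by_cases h : (A.submatrix f g).det = 0
  · exact Or.inr h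
  · refine hA k f g (fun i j hij => ?_) (fun i j hij => ?_) <;> by_contra hne <;> apply h
    · exact Matrix.det_zero_of_row_eq hne (by ext; simp [hij])
    · exact Matrix.det_zero_of_column_eq hne (by simp [hij])

lemma rowSpace_mul_le {m n r : ℕ} (P : Matrix (Fin m) (Fin r) ℂ) (X : Matrix (Fin r) (Fin n) ℂ) :
    rowSpace (P * X) ≤ rowSpace X := by
  refine Submodule.span_le.2 ?_
  rintro _ ⟨i, rfl⟩
  have : WithLp.toLp 2 ((P * X).row i) = ∑ b, P i b • WithLp.toLp 2 (X.row b) := by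
    ext j
    simp [Matrix.mul_apply]
  simp only [SetLike.mem_coe]
  rw [this]
  exact Submodule.sum_mem _ fun b _ => Submodule.smul_mem _ _ (Submodule.subset_span ⟨b, rfl⟩)

/-- Matrices over two fields with the same independent sets of columns have the same independent
families of columns. -/
lemma linearIndependent_comp_congr {F K ι V W κ : Type*} [Field F] [Field K] [AddCommGroup V]
    [Module F V] [AddCommGroup W] [Module K W] {v : ι → V} {w : ι → W}
    (h : ∀ J : Set ι, LinearIndepOn F v J ↔ LinearIndepOn K w J) (c : κ → ι) :
    LinearIndependent F (v ∘ c) ↔ LinearIndependent K (w ∘ c) := by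
  by_cases hc : c.Injective
  · rw [← linearIndepOn_range_iff hc, ← linearIndepOn_range_iff hc, h]
  · exact ⟨fun h' => absurd h'.injective.of_comp hc, fun h' => absurd h'.injective.of_comp hc⟩

/-- An `H`-matrix and a totally unimodular matrix with the same independent sets of columns have the
same row space up to scaling the coordinates by sixth roots of unity. -/
theorem exists_rowSpace_eq {m m' n : ℕ} {A : Matrix (Fin m) (Fin n) ℂ}
    {A₀ : Matrix (Fin m') (Fin n) ℝ} (hA : IsHMatrix A) (hA₀ : A₀.IsTotallyUnimodular)
    (h : ∀ J : Set (Fin n), LinearIndepOn ℂ A.col J ↔ LinearIndepOn ℝ A₀.col J) :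
    ∃ d : Fin n → ℂ, (∀ j, d j ^ 6 = 1) ∧
      rowSpace A = rowSpace (A₀.map Complex.ofRealHom * Matrix.diagonal d) := by
  obtain ⟨B, -, -, hspan, hB⟩ := exists_linearIndepOn_extension (K := ℝ) (v := A₀.col)
    (linearIndepOn_empty ℝ _) (Set.empty_subset Set.univ)
  classical
  obtain ⟨r, ⟨e⟩⟩ := Finite.exists_equiv_fin B
  set g : Fin r → Fin n := fun b => e.symm b with hgdef
  have hginj : g.Injective := Subtype.val_injective.comp e.symm.injective
  have hgB : Set.range g = B := by
    rw [hgdef, ← Function.comp_def, e.symm.surjective.range_comp]; simp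
  have hspan₀ : ∀ j, A₀.col j ∈ Submodule.span ℝ (Set.range (A₀.col ∘ g)) := fun j => by
    rw [Set.range_comp, hgB]; exact hspan ⟨j, Set.mem_univ j, rfl⟩
  have hspan₁ : ∀ j, A.col j ∈ Submodule.span ℂ (Set.range (A.col ∘ g)) := fun j => by
    rw [Set.range_comp, hgB]
    by_contra hj
    obtain ⟨hins, hjB⟩ := ((h B).2 hB).notMem_span_iff.1 hj
    exact hB.notMem_span_iff.2 ⟨(h _).1 hins, hjB⟩ (hspan ⟨j, Set.mem_univ j, rfl⟩)
  have hg₀ : LinearIndependent ℝ (A₀.col ∘ g) := by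
    rw [← linearIndepOn_range_iff hginj, hgB]; exact hB
  obtain ⟨X, P, Q, f, hXg, hP, hQ, hXdet⟩ := exists_standard_form A g
    ((linearIndependent_comp_congr h g).2 hg₀) hspan₁
  obtain ⟨Y, P₀, Q₀, f₀, hYg, hP₀, hQ₀, hYdet⟩ := exists_standard_form A₀ g hg₀ hspan₀
  have hsing : ∀ c : Fin r → Fin n, (X.submatrix id c).det = 0 ↔ (Y.submatrix id c).det = 0 := by
    intro c
    rw [← not_iff_not]
    exact (det_submatrix_ne_zero_iff X c).trans <|
      (linearIndependent_col_comp_iff hP hQ c).symm.trans <|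
      (linearIndependent_comp_congr h c).trans <|
      (linearIndependent_col_comp_iff hP₀ hQ₀ c).trans (det_submatrix_ne_zero_iff Y c).symm
  have hYunim : ∀ c : Fin r → Fin n, (Y.submatrix id c).det = 0 ∨ (Y.submatrix id c).det = 1 ∨
      (Y.submatrix id c).det = -1 := by
    intro c
    rw [hYdet]
    have hmem := (Matrix.isTotallyUnimodular_iff A₀).1 hA₀ r f₀
    obtain ⟨s, hs⟩ := hmem c
    obtain ⟨t, ht⟩ := hmem g
    rw [← hs, ← ht]
    cases s <;> cases t <;> simp
  have hYint : ∀ i j, ∃ z : ℤ, (z : ℝ) = Y i j := fun i j => by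
    rcases det_submatrix_update hYg i j ▸ hYunim (Function.update g i j) with h' | h' | h'
    · exact ⟨0, by simp [h']⟩
    · exact ⟨1, by simp [h']⟩
    · exact ⟨-1, by simp [h']⟩
  choose z hz using hYint
  set Z : Matrix (Fin r) (Fin n) ℤ := Matrix.of z with hZdef
  have hZ : ∀ i j, (Z i j : ℝ) = Y i j := hz
  have hZdet : ∀ c : Fin r → Fin n, ((Z.submatrix id c).det : ℝ) = (Y.submatrix id c).det := by
    intro c
    rw [← eq_intCast (Int.castRingHom ℝ), RingHom.map_det]
    congr 1
    ext i j
    simp [hZ]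
  have hX6 : ∀ i j, X i j ≠ 0 → X i j ^ 6 = 1 := by
    intro i j hij
    rw [← det_submatrix_update hXg, hXdet] at hij ⊢
    rw [div_pow]
    rcases hA.det_submatrix_mem f g with h1 | h1
    · rcases hA.det_submatrix_mem f (Function.update g i j) with h2 | h2
      · rw [h1, h2, div_one]
      · exact absurd (by rw [Set.mem_singleton_iff.1 h2, zero_div]) hij
    · exact absurd (by rw [Set.mem_singleton_iff.1 h1, div_zero]) hij
  obtain ⟨s, d, hs, hd, hXZ⟩ := exists_scaling (X := X) (X₀ := Z) hXg
    (fun a b => by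
      have := hZ a (g b)
      rw [hYg] at this
      split_ifs at this ⊢ <;> exact_mod_cast this)
    (fun c => by
      have := hYunim c
      rw [← hZdet c] at this
      exact_mod_cast this)
    (fun c hc => by rw [hsing, ← hZdet, hc, Int.cast_zero])
    (fun i j => by
      have := hsing (Function.update g i j)
      rw [det_submatrix_update hXg, det_submatrix_update hYg, ← hZ] at this
      rw [this]
      norm_cast)
    hX6
  refine ⟨d, hd, ?_⟩
  -- `X` and the standard form of `A₀` differ by the row scaling `s` and the column scaling `d`.
  have hXY : X = Matrix.diagonal s * (Y.map Complex.ofRealHom * Matrix.diagonal d) := by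
    ext i j
    rw [Matrix.diagonal_mul, Matrix.mul_diagonal, hXZ, Matrix.map_apply, ← hZ]
    simp [mul_assoc]
  have hYX : Y.map Complex.ofRealHom * Matrix.diagonal d = Matrix.diagonal (fun i => s i ^ 5) * X := by
    rw [hXY, ← Matrix.mul_assoc (Matrix.diagonal _), Matrix.diagonal_mul_diagonal]
    simp only [← pow_succ, hs, Matrix.diagonal_one, Matrix.one_mul]
  apply le_antisymm
  · have : A = (P * Matrix.diagonal s * Q₀.map Complex.ofRealHom) *
        (A₀.map Complex.ofRealHom * Matrix.diagonal d) := by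
      rw [Matrix.mul_assoc, ← Matrix.mul_assoc (Q₀.map _), ← Matrix.map_mul, ← hQ₀,
        Matrix.mul_assoc, ← hXY, ← hP]
    conv_lhs => rw [this]
    exact rowSpace_mul_le _ _
  · have : A₀.map Complex.ofRealHom * Matrix.diagonal d =
        (P₀.map Complex.ofRealHom * Matrix.diagonal (fun i => s i ^ 5) * Q) * A := by
      conv_lhs => rw [hP₀]
      rw [Matrix.map_mul, Matrix.mul_assoc, hYX, Matrix.mul_assoc _ Q, ← hQ, Matrix.mul_assoc]
    rw [this]
    exact rowSpace_mul_le _ _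

end RowSpace

/-! ### Monomial isometries and Jacobians -/

section Jacobian

lemma mem_eisenstein_of_pow_eq_one {z : ℂ} (hz : z ^ 6 = 1) : z ∈ Eisenstein := by
  have hω : IsPrimitiveRoot omega 6 := by
    simpa [omega] using Complex.isPrimitiveRoot_exp 6 (by norm_num)
  obtain ⟨i, -, rfl⟩ := hω.eq_pow_of_pow_eq_one hz
  exact Subalgebra.pow_mem _ (Algebra.self_mem_adjoin_singleton ℤ omega) i

/-- The monomial transformation that relabels the coordinates of `ℂⁿ` by `σ` and then scales them by
the sixth roots of unity `d`, as an isometry. -/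
noncomputable def monomialIsometry {n n' : ℕ} (σ : Fin n ≃ Fin n') (d : Fin n → ℂ)
    (hd : ∀ j, d j ^ 6 = 1) : EuclideanSpace ℂ (Fin n') ≃ₗᵢ[ℂ] EuclideanSpace ℂ (Fin n) where
  toFun v := WithLp.toLp 2 fun j => d j * v (σ j)
  invFun w := WithLp.toLp 2 fun i => d (σ.symm i) ^ 5 * w (σ.symm i)
  map_add' v w := by ext j; simp [mul_add]
  map_smul' c v := by ext j; simp [mul_left_comm]
  left_inv v := by ext i; simp [← mul_assoc, ← pow_succ, hd]
  right_inv w := by ext j; simp [← mul_assoc, ← pow_succ', hd]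
  norm_map' v := by
    have hnorm : ∀ j, ‖d j‖ = 1 := fun j => Complex.norm_eq_one_of_pow_eq_one (hd j) (by norm_num)
    simp only [EuclideanSpace.norm_eq, LinearEquiv.coe_mk, LinearMap.coe_mk, AddHom.coe_mk,
      norm_mul, hnorm, one_mul]
    rw [σ.sum_comp (fun i => ‖v i‖ ^ 2)]

/-- The restriction of `monomialIsometry` to vectors of Eisenstein integers. -/
noncomputable def monomialEquiv {n n' : ℕ} (σ : Fin n ≃ Fin n') (d : Fin n → ℂ)
    (hd : ∀ j, d j ^ 6 = 1) : (Fin n' → Eisenstein) ≃ₗ[Eisenstein] (Fin n → Eisenstein) where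
  toFun v j := ⟨d j, mem_eisenstein_of_pow_eq_one (hd j)⟩ * v (σ j)
  invFun w i := ⟨d (σ.symm i), mem_eisenstein_of_pow_eq_one (hd _)⟩ ^ 5 * w (σ.symm i)
  map_add' v w := by funext j; simp [mul_add]
  map_smul' c v := by funext j; simp [mul_left_comm]
  left_inv v := by funext i; ext; simp [← mul_assoc, ← pow_succ, hd]
  right_inv w := by funext j; ext; simp [← mul_assoc, ← pow_succ', hd]

lemma incl_monomialEquiv {n n' : ℕ} (σ : Fin n ≃ Fin n') (d : Fin n → ℂ)
    (hd : ∀ j, d j ^ 6 = 1) (v : Fin n' → Eisenstein) :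
    incl n (monomialEquiv σ d hd v) = monomialIsometry σ d hd (incl n' v) := rfl

lemma map_comap_incl {n n' : ℕ} (σ : Fin n ≃ Fin n') (d : Fin n → ℂ) (hd : ∀ j, d j ^ 6 = 1)
    (K : Submodule ℂ (EuclideanSpace ℂ (Fin n'))) :
    ((K.restrictScalars Eisenstein).comap (incl n')).map (monomialEquiv σ d hd).toLinearMap =
      ((K.map (monomialIsometry σ d hd).toLinearEquiv.toLinearMap).restrictScalars
        Eisenstein).comap (incl n) := by
  ext w
  obtain ⟨v, rfl⟩ := (monomialEquiv σ d hd).surjective w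
  simp only [Submodule.mem_map, Submodule.mem_comap, Submodule.restrictScalars_mem]
  constructor
  · rintro ⟨v', hv', h⟩
    refine ⟨incl n' v', hv', ?_⟩
    have := congrArg (incl n) h
    exact this
  · rintro ⟨x, hx, h⟩
    refine ⟨v, ?_, rfl⟩
    rw [incl_monomialEquiv] at h
    have := (monomialIsometry σ d hd).injective h
    rwa [← this]

/-- A monomial transformation by sixth roots of unity between row spaces induces an isomorphism of
Jacobians: being unitary, it also matches the orthogonal complements. -/
lemma nonempty_jac_equiv {m m' n n' : ℕ} {A : Matrix (Fin m) (Fin n) ℂ}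
    {B : Matrix (Fin m') (Fin n') ℂ} (σ : Fin n ≃ Fin n') (d : Fin n → ℂ) (hd : ∀ j, d j ^ 6 = 1)
    (h : rowSpace A = rowSpace (B.submatrix id σ * Matrix.diagonal d)) :
    Nonempty (Jac B ≃ₗ[Eisenstein] Jac A) := by
  have hmap : (rowSpace B).map (monomialIsometry σ d hd).toLinearEquiv.toLinearMap = rowSpace A := by
    rw [h, rowSpace, rowSpace, Submodule.map_span, ← Set.range_comp]
    congr 2
    funext i
    ext j
    simp [monomialIsometry, mul_comm]
  have hmap' : (rowSpace B)ᗮ.map (monomialIsometry σ d hd).toLinearEquiv.toLinearMap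
      = (rowSpace A)ᗮ := by
    rw [← hmap]
    exact Submodule.map_orthogonal_equiv (rowSpace B) (monomialIsometry σ d hd)
  refine ⟨Submodule.Quotient.equiv _ _ (monomialEquiv σ d hd) ?_⟩
  rw [Submodule.map_sup, lattice, latticeStar, lattice, latticeStar, map_comap_incl,
    map_comap_incl, hmap, hmap']

end Jacobian

/-! ### Regular matroids -/

section Regular

variable {α : Type*} {M : Matroid α}

lemma isHRepresentation_map_ofReal {m n : ℕ} {A : Matrix (Fin m) (Fin n) ℝ} {e : Fin n ≃ M.E}
    (hA : A.IsTotallyUnimodular) (h : Represents M A e) :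
    IsHRepresentation M (A.map Complex.ofRealHom) e := by
  refine ⟨fun k f g hf hg => ?_, fun J => (h J).trans ?_⟩
  · obtain ⟨s, hs⟩ := hA k f g hf hg
    rw [Matrix.submatrix_map, ← RingHom.mapMatrix_apply, ← RingHom.map_det, ← hs]
    cases s <;> simp [H, Even.neg_pow (show Even 6 by decide)]
  · exact (linearIndependent_algebraMap_comp_iff (R := ℝ) (S := ℂ)
      (v := fun j : J => A.col j)).symm

/-- The Jacobian of an `H`-representation is that of any totally unimodular representation. -/
lemma IsHRepresentation.nonempty_jac_equiv {m n m₀ n₀ : ℕ} {A : Matrix (Fin m) (Fin n) ℂ}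
    {e : Fin n ≃ M.E} {A₀ : Matrix (Fin m₀) (Fin n₀) ℝ} {e₀ : Fin n₀ ≃ M.E}
    (hA : IsHRepresentation M A e) (hA₀ : A₀.IsTotallyUnimodular) (h₀ : Represents M A₀ e₀) :
    Nonempty (Jac (A₀.map Complex.ofRealHom) ≃ₗ[Eisenstein] Jac A) := by
  set σ : Fin n ≃ Fin n₀ := e.trans e₀.symm with hσ
  obtain ⟨d, hd, hrow⟩ := exists_rowSpace_eq hA.1 (hA₀.submatrix id σ) fun J => by
    rw [← hA.2 J]
    have h1 : (fun j => (e j : α)) '' J = (fun j => (e₀ j : α)) '' (σ '' J) := by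
      rw [Set.image_image]; simp [hσ]
    rw [h1, h₀]
    exact (linearIndepOn_equiv σ).symm
  exact SixthRoot.nonempty_jac_equiv σ d hd hrow

end Regular

end SixthRoot

theorem mainTheorem3 {α : Type*} (M : Matroid α) (hM : SixthRoot.IsRegularMatroid M) :
    SixthRoot.IsSixthRootMatroid M ∧
    ∀ (m₁ m₂ n₁ n₂ : ℕ)
      (A₁ : Matrix (Fin m₁) (Fin n₁) ℂ) (e₁ : Fin n₁ ≃ M.E)
      (A₂ : Matrix (Fin m₂) (Fin n₂) ℂ) (e₂ : Fin n₂ ≃ M.E),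
      SixthRoot.IsHRepresentation M A₁ e₁ → SixthRoot.IsHRepresentation M A₂ e₂ →
      Nonempty (SixthRoot.Jac A₁ ≃ₗ[SixthRoot.Eisenstein] SixthRoot.Jac A₂) := by
  obtain ⟨m, n, A, e, hA, hAe⟩ := hM
  refine ⟨⟨m, n, _, e, SixthRoot.isHRepresentation_map_ofReal hA hAe⟩, ?_⟩
  intro m₁ m₂ n₁ n₂ A₁ e₁ A₂ e₂ h₁ h₂
  obtain ⟨φ₁⟩ := h₁.nonempty_jac_equiv hA hAe
  obtain ⟨φ₂⟩ := h₂.nonempty_jac_equiv hA hAe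
  exact ⟨φ₁.symm.trans φ₂⟩
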